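/- A finite poset $P$ is a tree poset if its Hasse diagram is a tree; it is graded if all its maximal chains have the same number of elements; its height is the number of elements in a longest chain. A set system $\mathcal{F}\subseteq 2^{[n]}$, ordered by inclusion, is $P$-free if there is no injective map $f:P\to\mathcal{F}$ such that $x\le y$ in $P$ implies $f(x)\subseteq f(y)$. Let $P$ be a finite graded tree poset of height $k$ and let $\varepsilon>0$ be fixed. Then for every $n$ there are a collection $\mathcal{C}=\mathcal{C}_n$ of pairs $(\mathcal{H},\mathcal{G})$ with $\mathcal{H},\mathcal{G}\subseteq 2^{[n]}$ and a function $\Psi=\Psi_n$ assigning to each $P$-free set system $\mathcal{F}\subseteq 2^{[n]}$ a pair $\Psi(\mathcal{F})\in\mathcal{C}$ such that: (i) if $\mathcal{F}\subseteq 2^{[n]}$ is $P$-free and $\Psi(\mathcal{F})=(\mathcal{H},\mathcal{G})$, then $\mathcal{H}\subseteq\mathcal{F}\subseteq\mathcal{H}\cup\mathcal{G}$; (ii) $|\mathcal{G}|\le (k-1+\varepsilon)\binom{n}{\lfloor n/2\rfloor}$ for every $(\mathcal{H},\mathcal{G})\in\mathcal{C}$; (iii) $|\mathcal{C}|=2^{O\left(\frac{\log\log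 n}{\log n}\binom{n}{\lfloor n/2\rfloor}\right)}$ as $n\to\infty$, where the implied constant may depend on $P$ and $\varepsilon$ but not on $n$. -/

import Mathlib

open Filter Asymptotics

/-- The poset `Q` contains the poset `P`: there is an injective poset homomorphism `P → Q`. -/
def PosetContains (Q P : Type*) [PartialOrder Q] [PartialOrder P] : Prop :=
  ∃ f : P →o Q, Function.Injective f

/-- The poset `Q` is `P`-free. -/
def PosetFree (Q P : Type*) [PartialOrder Q] [PartialOrder P] : Prop :=
  ¬ PosetContains Q P

/-- A tree poset: the Hasse diagram (the graph of the covering relation) is a tree. -/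
def IsTreePoset (P : Type*) [PartialOrder P] : Prop :=
  (SimpleGraph.hasse P).IsTree

/-- A (finite) poset is graded if all its maximal chains have the same size. -/
def IsGradedPoset (P : Type*) [PartialOrder P] : Prop :=
  ∀ s t : Set P, IsMaxChain (· ≤ ·) s → IsMaxChain (· ≤ ·) t → s.ncard = t.ncard

/-- A (finite) poset has height `k` if `k` is the number of elements of a longest maximal chain. -/
def HasPosetHeight (P : Type*) [PartialOrder P] (k : ℕ) : Prop :=
  IsGreatest {m : ℕ | ∃ s : Set P, IsMaxChain (· ≤ ·) s ∧ s.ncard = m} k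

/-- Set systems on `[n]`, that is, families of subsets of an `n`-element set; each of them is a
poset under inclusion. -/
abbrev SetSystem (n : ℕ) : Type := Finset (Finset (Fin n))

/-! Root the Hasse diagram; gradedness gives a rank that changes by exactly one along each edge. For
a `P`-free `F`, work from the leaves to the root: each vertex `v` gets a container `g v` of
middle-layer sets and a maximal fingerprint `S v ⊆ F` whose neighbourhoods delete many sets of `g v`
but few members of `F`. By maximality, a member of `F` with `D` neighbours left in `g v` has at
least `|P|` of them in `F` (`exists_containerSystem`). A member of `F` in the root container would
then start a greedy copy of `P` (`TreeRooting.exists_embedding`), so `F` avoids that container. Let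
`G` be the middle sets that are neither deleted nor in the root container: few middle members of `F`
lie outside `G`.

The bound on `G` is supersaturation along maximal chains (`mul_sum_card_prefixed_le`). In a window
of `k` consecutive members of `G` on a chain, put every vertex at its rank. As `G` misses the root
container, on some edge the parent's set has fewer than `D` candidates for the child's set, and one
of them is on the chain. A chain through a middle set meets a given comparable middle set with
probability at most `4 / n`. For `D` a small multiple of `n` such windows are rare, so an average
chain meets `G` in little more than `k - 1` sets.

The fingerprints determine `G` (`IsContainerSystem.unique`). Fingerprints and the middle part of `F
\ G` have size `O(2^n / n)`, and so has the family of non-middle sets, so there are `exp (O(2^n log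
n / n))` pairs. This is far below the target, because `2^n` is at most of order `√n` times the
middle binomial coefficient. -/

/-! ### Rooted trees. -/

/-- A rooted tree structure on `V`: `child x y` means that `y` is the parent of `x`. -/
structure TreeRooting (V : Type*) where
  child : V → V → Prop
  root : V
  depth : V → ℕ
  depth_child : ∀ {x y}, child x y → depth x = depth y + 1
  exists_parent : ∀ x, x ≠ root → ∃ y, child x y
  root_no_parent : ∀ y, ¬ child root y
  parent_unique : ∀ {x y z}, child x y → child x z → y = z

theorem TreeRooting.wellFounded_child {V : Type*} [Finite V] (T : TreeRooting V) :
    WellFounded T.child := by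
  obtain ⟨M, hM⟩ := (Set.finite_range T.depth).bddAbove
  refine Subrelation.wf ?_ (measure fun v => M - T.depth v).wf
  intro x y h
  have h1 := T.depth_child h
  have h2 : T.depth x ≤ M := hM ⟨x, rfl⟩
  simp only [WellFoundedRelation.rel, InvImage]
  omega

/-- A tree, rooted at one of its vertices. -/
theorem SimpleGraph.IsTree.exists_treeRooting {V : Type*} {G : SimpleGraph V} (hG : G.IsTree) :
    ∃ T : TreeRooting V, (∀ x y, T.child x y → G.Adj x y) ∧
      ∀ x y, G.Adj x y → T.child x y ∨ T.child y x := by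
  classical
  obtain ⟨r⟩ := hG.connected.nonempty
  refine ⟨{ child := fun x y => G.Adj x y ∧ G.dist r x = G.dist r y + 1
            root := r
            depth := G.dist r
            depth_child := fun h => h.2
            exists_parent := ?_
            root_no_parent := fun y h => by simp at h
            parent_unique := ?_ }, fun x y h => h.1, ?_⟩
  · intro x hx
    obtain ⟨p, hp, hl⟩ := hG.connected.exists_path_of_dist r x
    have hnil : ¬ p.Nil := SimpleGraph.Walk.not_nil_of_ne (Ne.symm hx)
    refine ⟨p.penultimate, (p.adj_penultimate hnil).symm, ?_⟩
    have h1 : G.dist r p.penultimate ≤ p.dropLast.length := SimpleGraph.dist_le _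
    have h2 : p.dropLast.length + 1 = p.length := p.length_dropLast_add_one hnil
    have h3 := hG.dist_eq_dist_add_one_of_adj r (p.adj_penultimate hnil)
    omega
  · rintro x y z ⟨hy, hyd⟩ ⟨hz, hzd⟩
    -- A neighbour closer to the root is the penultimate vertex of a path from the root, and that
    -- path is unique.
    have key : ∀ w, G.Adj x w → G.dist r x = G.dist r w + 1 →
        ∃ p : G.Walk r x, p.IsPath ∧ p.penultimate = w := by
      intro w hw hd
      obtain ⟨p, hp, hl⟩ := hG.connected.exists_path_of_dist r w
      refine ⟨p.concat hw.symm, ?_, by simp⟩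
      apply SimpleGraph.Walk.isPath_of_length_eq_dist
      simp [hl, hd]
    obtain ⟨p, hp, rfl⟩ := key y hy hyd
    obtain ⟨q, hq, rfl⟩ := key z hz hzd
    rw [(hG.existsUnique_path r x).unique hp hq]
  · intro x y h
    rcases hG.dist_eq_dist_add_one_of_adj r h with h1 | h1
    · exact Or.inl ⟨h, h1⟩
    · exact Or.inr ⟨h.symm, h1⟩

/-! ### Maximal chains and rank in graded posets. -/

/-- An element comparable with the whole spliced chain could be added to `s` if it is below `a` and
to `t` otherwise, since all other comparisons pass through `a`. -/
theorem IsMaxChain.Iio_union_Ici {P : Type*} [PartialOrder P] {s t : Set P} {a : P}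
    (hs : IsMaxChain (· ≤ ·) s) (ht : IsMaxChain (· ≤ ·) t) (has : a ∈ s) (hat : a ∈ t) :
    IsMaxChain (· ≤ ·) (s ∩ Set.Iio a ∪ t ∩ Set.Ici a) := by
  refine ⟨?_, ?_⟩
  · rintro x (⟨hx, hxa⟩ | ⟨hx, hxa⟩) y (⟨hy, hya⟩ | ⟨hy, hya⟩) hxy
    · exact hs.1 hx hy hxy
    · exact Or.inl (hxa.le.trans hya)
    · exact Or.inr (hya.le.trans hxa)
    · exact ht.1 hx hy hxy
  · intro u hu hsub
    refine hsub.antisymm fun z hz => ?_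
    have hau : a ∈ u := hsub (Or.inr ⟨hat, le_rfl⟩)
    have hcomp : ∀ w ∈ u, z ≤ w ∨ w ≤ z := fun w hw => hu.total hz hw
    by_cases hza : z < a
    · refine Or.inl ⟨?_, hza⟩
      have : IsChain (· ≤ ·) (insert z s) := by
        refine hs.1.insert fun b hb _ => ?_
        rcases hs.1.total hb has with h | h
        · rcases h.lt_or_eq with h | rfl
          · exact hcomp b (hsub (Or.inl ⟨hb, h⟩))
          · exact Or.inl hza.le
        · exact Or.inl (hza.le.trans h)
      rw [hs.2 this (Set.subset_insert _ _)]
      exact Set.mem_insert _ _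
    · have haz : a ≤ z := by
        rcases hcomp a hau with h | h
        · rcases h.lt_or_eq with h | rfl
          · exact absurd h hza
          · exact le_rfl
        · exact h
      refine Or.inr ⟨?_, haz⟩
      have : IsChain (· ≤ ·) (insert z t) := by
        refine ht.1.insert fun b hb _ => ?_
        rcases ht.1.total hb hat with h | h
        · exact Or.inr (h.trans haz)
        · exact hcomp b (hsub (Or.inr ⟨hb, h⟩))
      rw [ht.2 this (Set.subset_insert _ _)]
      exact Set.mem_insert _ _

theorem ncard_inter_Iio_add_Ici {P : Type*} [PartialOrder P] [Finite P] {s t : Set P} (a : P) :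
    (s ∩ Set.Iio a ∪ t ∩ Set.Ici a).ncard = (s ∩ Set.Iio a).ncard + (t ∩ Set.Ici a).ncard := by
  refine Set.ncard_union_eq ?_ (Set.toFinite _) (Set.toFinite _)
  rw [Set.disjoint_left]
  rintro x ⟨_, hx⟩ ⟨_, hx'⟩
  exact absurd hx (not_lt_of_ge hx')

theorem IsChain.Iio_union_Ici {P : Type*} [PartialOrder P] {s : Set P} {a : P}
    (hs : IsChain (· ≤ ·) s) (ha : a ∈ s) : s ∩ Set.Iio a ∪ s ∩ Set.Ici a = s := by
  rw [← Set.inter_union_distrib_left, Set.inter_eq_left]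
  intro x hx
  rcases hs.total hx ha with h | h
  · rcases h.lt_or_eq with h | rfl
    · exact Or.inl h
    · exact Or.inr le_rfl
  · exact Or.inr h

/-- In a graded poset the position of an element in a maximal chain does not depend on the
chain. -/
theorem IsGradedPoset.exists_rank {P : Type*} [PartialOrder P] [Finite P] {k : ℕ}
    (hG : IsGradedPoset P) (hk : HasPosetHeight P k) :
    ∃ ρ : P → ℕ, (∀ a, ρ a < k) ∧ ∀ a b, a ⋖ b → ρ b = ρ a + 1 := by
  obtain ⟨⟨s₀, hs₀, rfl⟩, -⟩ := hk
  have hcard : ∀ s : Set P, IsMaxChain (· ≤ ·) s → s.ncard = s₀.ncard := fun s hs => hG s s₀ hs hs₀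
  have hex : ∀ a : P, ∃ s : Set P, IsMaxChain (· ≤ ·) s ∧ a ∈ s := by
    intro a
    obtain ⟨s, hs, h⟩ := (Set.subsingleton_singleton (a := a)).isChain (r := (· ≤ ·)).exists_maxChain
    exact ⟨s, hs, h rfl⟩
  choose c hc hac using hex
  have indep : ∀ (s : Set P) (a : P), IsMaxChain (· ≤ ·) s → a ∈ s →
      (s ∩ Set.Iio a).ncard = (c a ∩ Set.Iio a).ncard := by
    intro s a hs ha
    have h1 := hcard _ (hs.Iio_union_Ici (hc a) ha (hac a))
    have h2 := hcard _ (hc a)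
    rw [ncard_inter_Iio_add_Ici] at h1
    rw [← (hc a).1.Iio_union_Ici (hac a), ncard_inter_Iio_add_Ici] at h2
    omega
  refine ⟨fun a => (c a ∩ Set.Iio a).ncard, fun a => ?_, fun a b hab => ?_⟩
  · rw [← hcard _ (hc a)]
    refine Set.ncard_lt_ncard ⟨Set.inter_subset_left, fun h => ?_⟩ (Set.toFinite _)
    exact lt_irrefl a (h (hac a)).2
  · obtain ⟨s, hs, h⟩ := (IsChain.pair (r := (· ≤ ·)) hab.le).exists_maxChain
    have has : a ∈ s := h (by simp)
    have hbs : b ∈ s := h (by simp)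
    change (c b ∩ Set.Iio b).ncard = (c a ∩ Set.Iio a).ncard + 1
    rw [← indep s a hs has, ← indep s b hs hbs,
      ← Set.ncard_insert_of_notMem (a := a) (by simp) (Set.toFinite _)]
    congr 1
    ext x
    simp only [Set.mem_inter_iff, Set.mem_Iio, Set.mem_insert_iff]
    constructor
    · rintro ⟨hx, hxb⟩
      rcases hs.1.total hx has with h | h
      · rcases h.lt_or_eq with h | h
        · exact Or.inr ⟨hx, h⟩
        · exact Or.inl h
      · rcases h.lt_or_eq with h | h
        · exact absurd hxb (hab.2 h)
        · exact Or.inl h.symm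
    · rintro (rfl | ⟨hx, hxa⟩)
      · exact ⟨has, hab.lt⟩
      · exact ⟨hx, hxa.trans hab.lt⟩

/-! ### Fingerprints, containers and greedy embedding. -/

section Containers

variable {α V : Type*} [DecidableEq α]

open Finset in
-- Take `S` of maximum size subject to both counts. A violating `A` could be added to `S`: it
-- deletes at least `D` new sets, fewer than `s` of them in `F`.
theorem exists_fingerprint (N : α → Finset α) (g F : Finset α) (D s : ℕ) (hD : 1 ≤ D) :
    ∃ S ⊆ F, #S * D ≤ #(g ∩ S.biUnion N) ∧ #(g ∩ S.biUnion N ∩ F) ≤ #S * s ∧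
      ∀ A ∈ F, D ≤ #((g \ S.biUnion N) ∩ N A) → s ≤ #((g \ S.biUnion N) ∩ N A ∩ F) := by
  obtain ⟨S, hS, hmax⟩ := (F.powerset.filter fun S =>
      #S * D ≤ #(g ∩ S.biUnion N) ∧ #(g ∩ S.biUnion N ∩ F) ≤ #S * s).exists_max_image card
    ⟨∅, by simp⟩
  simp only [mem_filter, mem_powerset] at hS hmax
  refine ⟨S, hS.1, hS.2.1, hS.2.2, fun A hA hDA => ?_⟩
  by_contra hlt
  push Not at hlt
  have hAS : A ∉ S := by
    intro hAS
    have : (g \ S.biUnion N) ∩ N A = ∅ := by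
      ext B
      simp only [mem_inter, Finset.mem_sdiff, mem_biUnion, notMem_empty, iff_false]
      rintro ⟨⟨_, h⟩, h'⟩
      exact h ⟨A, hAS, h'⟩
    rw [this] at hDA
    simp at hDA
    omega
  have hsplit : g ∩ (insert A S).biUnion N = (g ∩ S.biUnion N) ∪ ((g \ S.biUnion N) ∩ N A) := by
    ext B
    simp only [biUnion_insert, mem_inter, mem_union, Finset.mem_sdiff]
    tauto
  have hdisj : Disjoint (g ∩ S.biUnion N) ((g \ S.biUnion N) ∩ N A) := by
    rw [disjoint_left]
    intro B h h'
    simp only [mem_inter, Finset.mem_sdiff] at h h'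
    exact h'.1.2 h.2
  have := hmax (insert A S) ⟨insert_subset hA hS.1, ?_, ?_⟩
  · rw [card_insert_of_notMem hAS] at this
    omega
  · rw [hsplit, card_union_of_disjoint hdisj, card_insert_of_notMem hAS, add_mul, one_mul]
    exact add_le_add hS.2.1 hDA
  · rw [hsplit, union_inter_distrib_right, card_insert_of_notMem hAS, add_mul, one_mul]
    exact (card_union_le _ _).trans (add_le_add hS.2.2 hlt.le)

/-- `g v` consists of the members of `G₀` that have, for each child `x` of `v`, at least `D`
neighbours in `g x` after the neighbourhoods of the members of the fingerprint `S x` have been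
deleted. -/
def IsContainerSystem (T : TreeRooting V) (N : V → α → Finset α) (G₀ : Finset α) (D : ℕ)
    (g S : V → Finset α) : Prop :=
  ∀ v A, A ∈ g v ↔ A ∈ G₀ ∧
    ∀ x, T.child x v → D ≤ ((g x \ (S x).biUnion (N x)) ∩ N x A).card

/-- This lets containers be counted by their fingerprints alone, without reference to `F`. -/
theorem IsContainerSystem.unique [Finite V] {T : TreeRooting V} {N : V → α → Finset α}
    {G₀ : Finset α} {D : ℕ} {g g' S : V → Finset α} (h : IsContainerSystem T N G₀ D g S)
    (h' : IsContainerSystem T N G₀ D g' S) : g = g' := by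
  funext v
  induction v using T.wellFounded_child.induction with
  | _ v ih =>
    ext A
    rw [h v A, h' v A]
    refine and_congr_right fun _ => forall_congr' fun x => forall_congr' fun hx => ?_
    rw [ih x hx]

theorem WellFounded.exists_rec {V β : Type*} [Inhabited β] {r : V → V → Prop}
    (hr : WellFounded r) (step : V → (V → β) → β → Prop) (hex : ∀ v f, ∃ b, step v f b)
    (hcongr : ∀ v f f' b, (∀ x, r x v → f x = f' x) → step v f b → step v f' b) :
    ∃ f : V → β, ∀ v, step v f (f v) := by
  classical
  choose b hb using hex
  refine ⟨hr.fix fun v rec => b v fun x => if h : r x v then rec x h else default, fun v => ?_⟩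
  rw [hr.fix_eq]
  refine hcongr v _ _ _ (fun x hx => ?_) (hb v _)
  simp [hx]

open Finset in
/-- Every family `F` admits fingerprints `S v ⊆ F` such that a member of `F` with many neighbours
in a reduced container also has many neighbours in its intersection with `F`. -/
theorem exists_containerSystem [Finite V] (T : TreeRooting V) (N : V → α → Finset α)
    (G₀ F : Finset α) (D s : ℕ) (hD : 1 ≤ D) :
    ∃ g S : V → Finset α, IsContainerSystem T N G₀ D g S ∧ ∀ v, S v ⊆ F ∧
      #(S v) * D ≤ #(g v ∩ (S v).biUnion (N v)) ∧
      #(g v ∩ (S v).biUnion (N v) ∩ F) ≤ #(S v) * s ∧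
      ∀ A ∈ F, D ≤ #((g v \ (S v).biUnion (N v)) ∩ N v A) →
        s ≤ #((g v \ (S v).biUnion (N v)) ∩ N v A ∩ F) := by
  classical
  let step : V → (V → Finset α × Finset α) → Finset α × Finset α → Prop := fun v f b =>
    (∀ A, A ∈ b.1 ↔ A ∈ G₀ ∧
        ∀ x, T.child x v → D ≤ #(((f x).1 \ (f x).2.biUnion (N x)) ∩ N x A)) ∧ b.2 ⊆ F ∧
      #b.2 * D ≤ #(b.1 ∩ b.2.biUnion (N v)) ∧
      #(b.1 ∩ b.2.biUnion (N v) ∩ F) ≤ #b.2 * s ∧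
      ∀ A ∈ F, D ≤ #((b.1 \ b.2.biUnion (N v)) ∩ N v A) →
        s ≤ #((b.1 \ b.2.biUnion (N v)) ∩ N v A ∩ F)
  have hex : ∀ v f, ∃ b, step v f b := by
    intro v f
    obtain ⟨S, h1, h2, h3, h4⟩ := exists_fingerprint (N v) (G₀.filter fun A =>
      ∀ x, T.child x v → D ≤ #(((f x).1 \ (f x).2.biUnion (N x)) ∩ N x A)) F D s hD
    exact ⟨⟨_, S⟩, fun A => mem_filter, h1, h2, h3, h4⟩
  have hcongr : ∀ v f f' b, (∀ x, T.child x v → f x = f' x) → step v f b → step v f' b := by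
    rintro v f f' b hff ⟨h, h'⟩
    refine ⟨fun A => ?_, h'⟩
    rw [h A]
    refine and_congr_right fun _ => forall_congr' fun x => forall_congr' fun hx => ?_
    rw [hff x hx]
  obtain ⟨f, hf⟩ := T.wellFounded_child.exists_rec step hex hcongr
  exact ⟨fun v => (f v).1, fun v => (f v).2, fun v => (hf v).1, fun v => (hf v).2⟩

theorem TreeRooting.exists_notMem_parent_mem (T : TreeRooting V) (U : Set V) (hr : T.root ∈ U)
    (hU : U ≠ Set.univ) : ∃ x y, x ∉ U ∧ y ∈ U ∧ T.child x y := by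
  by_contra! h
  refine hU (Set.eq_univ_of_forall fun x => ?_)
  induction hd : T.depth x generalizing x with
  | zero =>
    by_contra hx
    obtain ⟨y, hy⟩ := T.exists_parent x (fun hxr => hx (hxr ▸ hr))
    have := T.depth_child hy
    omega
  | succ d ih =>
    by_contra hx
    obtain ⟨y, hy⟩ := T.exists_parent x (fun hxr => hx (hxr ▸ hr))
    have := T.depth_child hy
    exact h x y hx (ih y (by omega)) hy

open Finset in
/-- Greedy embedding of a rooted tree, starting from the root. -/
theorem TreeRooting.exists_embedding [Fintype V] (T : TreeRooting V) (N : V → α → Finset α)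
    (F : Finset α) (g : V → Finset α)
    (hg : ∀ x y, T.child x y → ∀ A ∈ F, A ∈ g y → Fintype.card V ≤ #(g x ∩ N x A ∩ F))
    (hroot : ∃ A ∈ F, A ∈ g T.root) :
    ∃ f : V → α, Function.Injective f ∧ (∀ v, f v ∈ F) ∧
      ∀ x y, T.child x y → f x ∈ N x (f y) := by
  classical
  obtain ⟨A₀, hA₀F, hA₀⟩ := hroot
  -- Partial embeddings of parent-closed vertex sets containing the root; a largest one is shown to
  -- be total.
  let good : Finset V → Prop := fun U => T.root ∈ U ∧ ∃ f : V → α, Set.InjOn f U ∧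
    (∀ v ∈ U, f v ∈ F ∧ f v ∈ g v) ∧ ∀ x y, x ∈ U → T.child x y → y ∈ U ∧ f x ∈ N x (f y)
  have hne : (univ.filter good).Nonempty := by
    refine ⟨{T.root}, ?_⟩
    simp only [mem_filter, mem_univ, true_and, good, mem_singleton, coe_singleton]
    refine ⟨fun _ => A₀, Set.injOn_singleton _ _, fun v hv => hv ▸ ⟨hA₀F, hA₀⟩, ?_⟩
    rintro x y rfl h
    exact absurd h (T.root_no_parent y)
  obtain ⟨U, hU, hmax⟩ := exists_max_image _ card hne
  simp only [mem_filter, mem_univ, true_and] at hU hmax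
  obtain ⟨hrU, f, hinj, hf, hch⟩ := hU
  by_cases huniv : U = univ
  · subst huniv
    refine ⟨f, ?_, fun v => (hf v (mem_univ v)).1, fun x y h => (hch x y (mem_univ x) h).2⟩
    simpa [Set.injOn_univ] using hinj
  obtain ⟨x, y, hx, hy, hxy⟩ := T.exists_notMem_parent_mem (U : Set V) (by simpa using hrU)
    (fun h => huniv (by simpa using h))
  rw [mem_coe] at hx hy
  have hcard : #(U.image f) < #(g x ∩ N x (f y) ∩ F) := by
    refine lt_of_lt_of_le ?_ (hg x y hxy (f y) (hf y hy).1 (hf y hy).2)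
    exact card_image_le.trans_lt ((card_lt_iff_ne_univ U).2 huniv)
  obtain ⟨B, hB, hBU⟩ := exists_mem_notMem_of_card_lt_card hcard
  simp only [mem_inter] at hB
  have hfU : ∀ v ∈ U, Function.update f x B v = f v := fun v hv =>
    Function.update_of_ne (by rintro rfl; exact hx hv) _ _
  have hfx : Function.update f x B x = B := Function.update_self _ _ _
  have := hmax (insert x U) ⟨mem_insert_of_mem hrU, Function.update f x B, ?_, ?_, ?_⟩
  · rw [card_insert_of_notMem hx] at this
    omega
  · rw [coe_insert, Set.injOn_insert (by simpa using hx)]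
    refine ⟨fun v hv w hw h => ?_, ?_⟩
    · rw [hfU v hv, hfU w hw] at h
      exact hinj hv hw h
    · rintro ⟨v, hv, h⟩
      rw [hfU v hv, hfx] at h
      exact hBU (mem_image.2 ⟨v, hv, h⟩)
  · intro v hv
    rcases mem_insert.1 hv with rfl | hv
    · rw [hfx]
      exact ⟨hB.2, hB.1.1⟩
    · rw [hfU v hv]
      exact hf v hv
  · intro v w hv hvw
    rcases mem_insert.1 hv with rfl | hv
    · obtain rfl := T.parent_unique hvw hxy
      rw [hfx, hfU w hy]
      exact ⟨mem_insert_of_mem hy, hB.1.2⟩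
    · obtain ⟨hw, h⟩ := hch v w hv hvw
      rw [hfU v hv, hfU w hw]
      exact ⟨mem_insert_of_mem hw, h⟩

end Containers

/-! ### Supersaturation by counting maximal chains. -/

section Supersaturation

open Finset Nat

/-- Members of a chain have distinct sizes, so sorting by size enumerates them. -/
theorem Finset.exists_chain_enum {α : Type*} [DecidableEq α] (C : Finset (Finset α))
    (hC : IsChain (· ⊆ ·) (C : Set (Finset α))) :
    ∃ e : ℕ → Finset α, (∀ t < #C, e t ∈ C) ∧ ∀ i j, i < j → j < #C → e i ⊂ e j := by
  have hinj : Set.InjOn card (C : Set (Finset α)) := by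
    intro A hA B hB h
    rcases hC.total hA hB with h' | h'
    · exact eq_of_subset_of_card_le h' h.ge
    · exact (eq_of_subset_of_card_le h' h.le).symm
  have hcard : #(C.image card) = #C := card_image_of_injOn hinj
  let o := (C.image card).orderEmbOfFin hcard
  have hmem : ∀ i : Fin #C, ∃ A ∈ C, #A = o i := fun i =>
    mem_image.1 ((C.image card).orderEmbOfFin_mem hcard i)
  choose e he hcarde using hmem
  refine ⟨fun t => if h : t < #C then e ⟨t, h⟩ else ∅, fun t ht => by simp [ht, he], ?_⟩
  intro i j hij hj
  have hi : i < #C := hij.trans hj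
  simp only [hi, hj, dif_pos]
  have hlt : #(e ⟨i, hi⟩) < #(e ⟨j, hj⟩) := by
    rw [hcarde, hcarde]
    exact o.strictMono hij
  rcases hC.total (he ⟨i, hi⟩) (he ⟨j, hj⟩) with h | h
  · exact ⟨h, fun h' => absurd (card_le_card h') (by omega)⟩
  · exact absurd (card_le_card h) (by omega)

theorem Nat.factorial_mul_factorial_le (i j : ℕ) : (i + 1)! * (j + 1)! ≤ (i + j + 1)! := by
  induction j with
  | zero => simp
  | succ j ih =>
    rw [Nat.factorial_succ (j + 1), ← add_assoc i j 1, Nat.factorial_succ (i + j + 1)]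
    calc (i + 1)! * ((j + 1 + 1) * (j + 1)!) = (j + 1 + 1) * ((i + 1)! * (j + 1)!) := by ring
      _ ≤ (i + j + 1 + 1) * (i + j + 1)! := Nat.mul_le_mul (by omega) ih

/-- Equivalent to `(i + j).choose i ≥ i + j`. -/
theorem Nat.add_mul_factorial_mul_factorial_le {i j : ℕ} (hi : 0 < i) (hj : 0 < j) :
    (i + j) * (i ! * j !) ≤ (i + j)! := by
  obtain ⟨i, rfl⟩ := Nat.exists_eq_add_one.2 hi
  obtain ⟨j, rfl⟩ := Nat.exists_eq_add_one.2 hj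
  have : i + 1 + (j + 1) = i + j + 1 + 1 := by ring
  rw [this, Nat.factorial_succ (i + j + 1)]
  exact Nat.mul_le_mul_left _ (Nat.factorial_mul_factorial_le i j)

namespace Numbering

variable {X : Type*} [Fintype X] [DecidableEq X]

/-- Such a numbering splits into a numbering of `A` and one of the complement that has `B \ A` as a
prefix. -/
theorem card_prefixed_inter_le {A B : Finset X} (hAB : A ⊆ B) :
    #(prefixed A ∩ prefixed B) ≤ (#A)! * ((#B - #A)! * (Fintype.card X - #B)!) := by
  let B' : Finset ↥(Aᶜ) := B.subtype (· ∈ Aᶜ)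
  have hB' : #B' = #B - #A := by
    rw [card_subtype, ← card_sdiff_of_subset hAB]
    congr 1
    ext x
    simp [and_comm]
  have hcard : #((univ : Finset (Numbering A)) ×ˢ prefixed B') =
      (#A)! * ((#B - #A)! * (Fintype.card X - #B)!) := by
    rw [card_product, card_prefixed, hB']
    have : Fintype.card ↥(Aᶜ) = Fintype.card X - #A := by simp
    rw [this]
    have h1 : #A ≤ #B := card_le_card hAB
    have h2 : Fintype.card X - #A - (#B - #A) = Fintype.card X - #B := by omega
    rw [h2, Finset.card_univ, Fintype.card_numbering, Fintype.card_coe]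
  rw [← hcard]
  refine card_le_card_of_injOn
    (fun f => if h : f ∈ prefixed A then prefixedEquiv A ⟨f, h⟩ else
      (Fintype.equivFin _, Fintype.equivFin _)) ?_ ?_
  · intro f hf
    have hf' := mem_inter.1 hf
    simp only [hf'.1, dif_pos, coe_product, Set.mem_prod, mem_coe, mem_univ, true_and,
      mem_prefixed]
    rintro ⟨x, hx⟩
    have h1 := mem_prefixed.1 hf'.2 x
    have hxA : ¬ (f x : ℕ) < #A := fun h => (mem_compl.1 hx) ((mem_prefixed.1 hf'.1 x).2 h)
    have h2 : (((prefixedEquiv A ⟨f, hf'.1⟩).2 ⟨x, hx⟩ : Fin _) : ℕ) = f x - #A := rfl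
    rw [h2, hB']
    simp only [B', mem_subtype, h1]
    omega
  · intro f hf f' hf' h
    have hf1 := (mem_inter.1 hf).1
    have hf1' := (mem_inter.1 hf').1
    simp only [hf1, hf1', dif_pos, EmbeddingLike.apply_eq_iff_eq, Subtype.mk.injEq] at h
    exact h

theorem mul_card_prefixed_inter_le_left {A B : Finset X} (hAB : A ⊂ B) (hB : B ≠ univ) :
    (Fintype.card X - #A) * #(prefixed A ∩ prefixed B) ≤ #(prefixed A) := by
  have h1 : #A < #B := card_lt_card hAB
  have h2 : #B < Fintype.card X := (card_lt_iff_ne_univ B).2 hB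
  rw [card_prefixed]
  calc (Fintype.card X - #A) * #(prefixed A ∩ prefixed B)
      ≤ (Fintype.card X - #A) * ((#A)! * ((#B - #A)! * (Fintype.card X - #B)!)) :=
        Nat.mul_le_mul_left _ (card_prefixed_inter_le hAB.1)
    _ = (#A)! * (((#B - #A) + (Fintype.card X - #B)) *
          ((#B - #A)! * (Fintype.card X - #B)!)) := by
        rw [show #B - #A + (Fintype.card X - #B) = Fintype.card X - #A by omega]
        ring
    _ ≤ (#A)! * ((#B - #A) + (Fintype.card X - #B))! := Nat.mul_le_mul_left _
        (Nat.add_mul_factorial_mul_factorial_le (by omega) (by omega))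
    _ = _ := by rw [show #B - #A + (Fintype.card X - #B) = Fintype.card X - #A by omega]

theorem mul_card_prefixed_inter_le_right {A B : Finset X} (hAB : A ⊂ B) (hA : A.Nonempty) :
    #B * #(prefixed A ∩ prefixed B) ≤ #(prefixed B) := by
  have h1 : #A < #B := card_lt_card hAB
  have h2 : 0 < #A := hA.card_pos
  rw [card_prefixed]
  calc #B * #(prefixed A ∩ prefixed B)
      ≤ #B * ((#A)! * ((#B - #A)! * (Fintype.card X - #B)!)) :=
        Nat.mul_le_mul_left _ (card_prefixed_inter_le hAB.1)
    _ = ((#A + (#B - #A)) * ((#A)! * (#B - #A)!)) * (Fintype.card X - #B)! := by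
        rw [show #A + (#B - #A) = #B by omega]
        ring
    _ ≤ (#A + (#B - #A))! * (Fintype.card X - #B)! := Nat.mul_le_mul_right _
        (Nat.add_mul_factorial_mul_factorial_le (by omega) (by omega))
    _ = _ := by rw [show #A + (#B - #A) = #B by omega]

end Numbering

/-- The sets strictly above `A` (if `u` is true) or strictly below `A` (otherwise). -/
def dirNbr {X : Type*} [Fintype X] [DecidableEq X] (u : Bool) (A : Finset X) :
    Finset (Finset X) :=
  univ.filter fun B => if u then A ⊂ B else B ⊂ A

open Numbering

/-- Both `#A` and `n - #A` are at least `n / 4`, which serves the downward and the upward case. -/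
theorem mul_card_prefixed_inter_le {n : ℕ} (hn : 0 < n) {A B : Finset (Fin n)} {u : Bool}
    (hA : n ≤ 4 * #A ∧ 4 * #A ≤ 3 * n) (hB : n ≤ 4 * #B ∧ 4 * #B ≤ 3 * n)
    (h : B ∈ dirNbr u A) : n * #(prefixed A ∩ prefixed B) ≤ 4 * #(prefixed A) := by
  cases u
  · have hBA : B ⊂ A := by simpa [dirNbr] using h
    have h1 := mul_card_prefixed_inter_le_right hBA (card_pos.1 (by omega))
    rw [inter_comm]
    calc n * #(prefixed B ∩ prefixed A) ≤ (4 * #A) * #(prefixed B ∩ prefixed A) :=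
          Nat.mul_le_mul_right _ hA.1
      _ = 4 * (#A * #(prefixed B ∩ prefixed A)) := by ring
      _ ≤ _ := Nat.mul_le_mul_left _ h1
  · have hAB : A ⊂ B := by simpa [dirNbr] using h
    have h1 := mul_card_prefixed_inter_le_left hAB (by
      rintro rfl
      simp at hB
      omega)
    have hc : Fintype.card (Fin n) = n := Fintype.card_fin n
    calc n * #(prefixed A ∩ prefixed B) ≤
          (4 * (Fintype.card (Fin n) - #A)) * #(prefixed A ∩ prefixed B) :=
          Nat.mul_le_mul_right _ (by omega)
      _ = 4 * ((Fintype.card (Fin n) - #A) * #(prefixed A ∩ prefixed B)) := by ring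
      _ ≤ _ := Nat.mul_le_mul_left _ h1

theorem factorial_le_choose_mul_card_prefixed {n : ℕ} (A : Finset (Fin n)) :
    n ! ≤ n.choose (n / 2) * #(prefixed A) := by
  have hA : #A ≤ n := by simpa using card_le_univ A
  rw [card_prefixed, Fintype.card_fin, ← Nat.choose_mul_factorial_mul_factorial hA, mul_assoc]
  exact Nat.mul_le_mul_right _ (Nat.choose_le_middle _ _)

/-- The number of pairs consisting of a numbering and a window of `k` members of `G` among its
prefixes is small if `G` contains no richly branching copy of the rooted tree `T`. -/
theorem mul_sum_card_prefixed_le {V : Type*} [Fintype V] (T : TreeRooting V) (up : V → Bool)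
    (ρ : V → ℕ) {k : ℕ} (hρ : ∀ v, ρ v < k)
    (hup : ∀ x y, T.child x y → if up x then ρ x = ρ y + 1 else ρ y = ρ x + 1)
    {n D : ℕ} (hn : 0 < n) (G : Finset (Finset (Fin n)))
    (hmid : ∀ A ∈ G, n ≤ 4 * #A ∧ 4 * #A ≤ 3 * n) (g : V → Finset (Finset (Fin n)))
    (hg : ∀ A ∈ G, ∀ v, A ∈ g v ∨ ∃ x, T.child x v ∧ #(g x ∩ dirNbr (up x) A) < D)
    (hroot : Disjoint G (g T.root)) :
    n * ∑ A ∈ G, #(prefixed A) ≤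
      n * ((k - 1) * n !) + Fintype.card V ^ 2 * (4 * D * ∑ A ∈ G, #(prefixed A)) := by
  classical
  let C : Numbering (Fin n) → Finset (Finset (Fin n)) := fun f => G.filter fun A => f.IsPrefix A
  have hchain : ∀ f, IsChain (· ⊆ ·) (C f : Set (Finset (Fin n))) := by
    intro f A hA B hB _
    have hA' := (mem_filter.1 hA).2
    have hB' := (mem_filter.1 hB).2
    rcases le_total #A #B with h | h
    · exact Or.inl (hA'.subset_of_card_le_card hB' h)
    · exact Or.inr (hB'.subset_of_card_le_card hA' h)
  choose e heC hemono using fun f => exists_chain_enum (C f) (hchain f)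
  have hinj : ∀ f i j, i < #(C f) → j < #(C f) → e f i = e f j → i = j := by
    intro f i j hi hj h
    rcases lt_trichotomy i j with h' | h' | h'
    · exact absurd h (hemono f i j h' hj).ne
    · exact h'
    · exact absurd h.symm (hemono f j i h' hi).ne
  have hwt : ∑ A ∈ G, #(prefixed A) = ∑ f, #(C f) := by
    have := sum_card_bipartiteAbove_eq_sum_card_bipartiteBelow (s := G)
      (t := (univ : Finset (Numbering (Fin n)))) fun A f => f.IsPrefix A
    exact this
  -- Windows are indexed by their starting position; truncated subtraction gives none for chains
  -- with fewer than `k` members.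
  let W : Finset (Σ _ : Numbering (Fin n), ℕ) := univ.sigma fun f => range (#(C f) - (k - 1))
  have hWmem : ∀ w ∈ W, ∀ v, w.2 + ρ v < #(C w.1) := by
    intro w hw v
    have h1 := mem_range.1 (mem_sigma.1 hw).2
    have h2 := hρ v
    omega
  have hWcard : ∑ A ∈ G, #(prefixed A) ≤ #W + (k - 1) * n ! := by
    rw [hwt, card_sigma]
    have : (k - 1) * n ! = ∑ _f : Numbering (Fin n), (k - 1) := by
      rw [sum_const, Finset.card_univ, Fintype.card_numbering, Fintype.card_fin, smul_eq_mul,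
        mul_comm]
    rw [this, ← sum_add_distrib]
    refine sum_le_sum fun f _ => ?_
    rw [card_range]
    omega
  let L : V → Finset (Fin n) → Finset (Finset (Fin n)) := fun x A =>
    if #(g x ∩ dirNbr (up x) A) < D then (g x ∩ dirNbr (up x) A) ∩ G else ∅
  have hLcard : ∀ x A, #(L x A) ≤ D := by
    intro x A
    simp only [L]
    split_ifs with h
    · exact (card_le_card inter_subset_left).trans h.le
    · simp
  have hLmem : ∀ x A B, B ∈ L x A → B ∈ dirNbr (up x) A ∧ B ∈ G := by
    intro x A B hB
    simp only [L] at hB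
    split_ifs at hB with h
    · simp only [mem_inter] at hB
      exact ⟨hB.1.2, hB.2⟩
    · simp at hB
  -- Windows that fail at the pair `p`: the set at the rank of `p.1` is among the few candidates for
  -- the set at the rank of `p.2`.
  let E : V × V → Finset (Σ _ : Numbering (Fin n), ℕ) := fun p =>
    W.filter fun w => e w.1 (w.2 + ρ p.1) ∈ L p.1 (e w.1 (w.2 + ρ p.2))
  have hEcard : ∀ p, n * #(E p) ≤ 4 * D * ∑ A ∈ G, #(prefixed A) := by
    rintro ⟨x, y⟩
    have h1 : #(E (x, y)) ≤
        #(G.sigma fun A => (L x A).sigma fun B => prefixed A ∩ prefixed B) := by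
      refine card_le_card_of_injOn
        (fun w => ⟨e w.1 (w.2 + ρ y), e w.1 (w.2 + ρ x), w.1⟩) ?_ ?_
      · intro w hw
        obtain ⟨hw, hL⟩ := mem_filter.1 hw
        have hy := mem_filter.1 (heC w.1 _ (hWmem w hw y))
        have hx := mem_filter.1 (heC w.1 _ (hWmem w hw x))
        simp only [mem_coe, mem_sigma, mem_inter, mem_prefixed]
        exact ⟨hy.1, hL, hy.2, hx.2⟩
      · rintro ⟨f, t⟩ hw ⟨f', t'⟩ hw' h
        have hw := hWmem _ (mem_filter.1 hw).1 y
        have hw' := hWmem _ (mem_filter.1 hw').1 y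
        simp only [Sigma.mk.injEq] at h
        obtain ⟨h1, h2⟩ := h
        have hff : f = f' := by
          have h3 := eq_of_heq h2
          simp only [Sigma.mk.injEq] at h3
          exact eq_of_heq h3.2
        subst hff
        have := hinj f _ _ hw hw' h1
        simp only at this
        obtain rfl : t = t' := by omega
        rfl
    calc n * #(E (x, y)) ≤
        n * #(G.sigma fun A => (L x A).sigma fun B => prefixed A ∩ prefixed B) :=
          Nat.mul_le_mul_left _ h1
      _ = ∑ A ∈ G, ∑ B ∈ L x A, n * #(prefixed A ∩ prefixed B) := by
          simp only [Finset.card_sigma, mul_sum]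
      _ ≤ ∑ A ∈ G, ∑ B ∈ L x A, 4 * #(prefixed A) := by
          refine sum_le_sum fun A hA => sum_le_sum fun B hB => ?_
          obtain ⟨hB1, hB2⟩ := hLmem x A B hB
          exact mul_card_prefixed_inter_le hn (hmid A hA) (hmid B hB2) hB1
      _ ≤ ∑ A ∈ G, D * (4 * #(prefixed A)) := by
          refine sum_le_sum fun A _ => ?_
          rw [sum_const, smul_eq_mul]
          exact Nat.mul_le_mul_right _ (hLcard x A)
      _ = 4 * D * ∑ A ∈ G, #(prefixed A) := by
          rw [mul_sum]
          exact sum_congr rfl fun A _ => by ring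
  have hcover : W ⊆ univ.biUnion E := by
    intro w hw
    by_contra hnot
    -- If no pair fails, membership in the containers spreads from the leaves to the root, where it
    -- is impossible.
    have key : ∀ v, e w.1 (w.2 + ρ v) ∈ g v := by
      intro v
      induction v using T.wellFounded_child.induction with
      | _ v ih =>
        have hAG := (mem_filter.1 (heC w.1 _ (hWmem w hw v))).1
        rcases hg _ hAG v with h | ⟨x, hx, hlt⟩
        · exact h
        · refine absurd ?_ hnot
          refine mem_biUnion.2 ⟨(x, v), mem_univ _, mem_filter.2 ⟨hw, ?_⟩⟩
          simp only [L, hlt, if_true, mem_inter]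
          refine ⟨⟨ih x hx, ?_⟩, (mem_filter.1 (heC w.1 _ (hWmem w hw x))).1⟩
          have h1 := hup x v hx
          cases hu : up x
          · simp only [hu, Bool.false_eq_true, if_false] at h1
            simpa [dirNbr] using hemono w.1 _ _ (by omega) (hWmem w hw v)
          · simp only [hu, if_true] at h1
            simpa [dirNbr] using hemono w.1 _ _ (by omega) (hWmem w hw x)
    exact disjoint_left.1 hroot (mem_filter.1 (heC w.1 _ (hWmem w hw T.root))).1 (key T.root)
  have hW : n * #W ≤ Fintype.card V ^ 2 * (4 * D * ∑ A ∈ G, #(prefixed A)) := by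
    calc n * #W ≤ n * ∑ p : V × V, #(E p) :=
          Nat.mul_le_mul_left _ ((card_le_card hcover).trans card_biUnion_le)
      _ = ∑ p : V × V, n * #(E p) := mul_sum _ _ _
      _ ≤ ∑ _p : V × V, 4 * D * ∑ A ∈ G, #(prefixed A) := sum_le_sum fun p _ => hEcard p
      _ = _ := by
        rw [sum_const, Finset.card_univ, Fintype.card_prod, smul_eq_mul, sq]
  calc n * ∑ A ∈ G, #(prefixed A) ≤ n * (#W + (k - 1) * n !) := Nat.mul_le_mul_left _ hWcard
    _ = n * ((k - 1) * n !) + n * #W := by ring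
    _ ≤ _ := Nat.add_le_add_left hW _

/-- Each set is a prefix of at least a `1 / n.choose (n / 2)` fraction of the numberings, so the
weighted bound becomes a bound on `#G`. -/
theorem card_le_of_disjoint_root {V : Type*} [Fintype V] (T : TreeRooting V) (up : V → Bool)
    (ρ : V → ℕ) {k : ℕ} (hρ : ∀ v, ρ v < k)
    (hup : ∀ x y, T.child x y → if up x then ρ x = ρ y + 1 else ρ y = ρ x + 1)
    {n D : ℕ} {ε : ℝ} (hε : 0 < ε)
    (hD : 4 * D * (Fintype.card V : ℝ) ^ 2 * (k - 1 + ε) < ε * n) (G : Finset (Finset (Fin n)))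
    (hmid : ∀ A ∈ G, n ≤ 4 * #A ∧ 4 * #A ≤ 3 * n) (g : V → Finset (Finset (Fin n)))
    (hg : ∀ A ∈ G, ∀ v, A ∈ g v ∨ ∃ x, T.child x v ∧ #(g x ∩ dirNbr (up x) A) < D)
    (hroot : Disjoint G (g T.root)) :
    (#G : ℝ) ≤ (k - 1 + ε) * (n.choose (n / 2) : ℝ) := by
  have hk1 : 1 ≤ k := by
    have := hρ T.root
    omega
  have hk : (0 : ℝ) ≤ (k : ℝ) - 1 := by
    have : (1 : ℝ) ≤ k := by exact_mod_cast hk1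
    linarith
  have hn : 0 < n := by
    rcases Nat.eq_zero_or_pos n with rfl | h
    · have : (0 : ℝ) ≤ 4 * D * (Fintype.card V : ℝ) ^ 2 * (k - 1 + ε) := by positivity
      simp at hD
      linarith
    · exact h
  have hn' : (0 : ℝ) < n := by exact_mod_cast hn
  by_contra hlt
  push Not at hlt
  set w : ℝ := ((∑ A ∈ G, #(prefixed A) : ℕ) : ℝ) with hw
  have h1 : (n : ℝ) * w ≤ n * ((k - 1) * (n ! : ℝ)) + (Fintype.card V : ℝ) ^ 2 * (4 * D * w) := by
    have := mul_sum_card_prefixed_le T up ρ hρ hup hn G hmid g hg hroot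
    have := (Nat.cast_le (α := ℝ)).2 this
    rw [Nat.cast_add, Nat.cast_mul, Nat.cast_mul, Nat.cast_mul, Nat.cast_mul, Nat.cast_mul,
      Nat.cast_sub hk1] at this
    simpa [hw] using this
  have h2 : (#G : ℝ) * (n ! : ℝ) ≤ (n.choose (n / 2) : ℝ) * w := by
    have : #G * n ! ≤ n.choose (n / 2) * ∑ A ∈ G, #(prefixed A) := by
      rw [mul_sum, ← smul_eq_mul, ← sum_const]
      exact sum_le_sum fun A _ => factorial_le_choose_mul_card_prefixed A
    rw [hw]
    exact_mod_cast this
  have hN : (0 : ℝ) < (n.choose (n / 2) : ℝ) := by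
    exact_mod_cast Nat.choose_pos (Nat.div_le_self n 2)
  have hf : (0 : ℝ) < (n ! : ℝ) := by exact_mod_cast Nat.factorial_pos n
  have h3 : (k - 1 + ε) * (n ! : ℝ) < w := by
    have : (n.choose (n / 2) : ℝ) * ((k - 1 + ε) * (n ! : ℝ)) < (n.choose (n / 2) : ℝ) * w := by
      refine lt_of_lt_of_le ?_ h2
      have := mul_lt_mul_of_pos_right hlt hf
      linarith
    exact lt_of_mul_lt_mul_left this hN.le
  have hwpos : 0 < w := lt_of_le_of_lt (by positivity) h3
  have h4 := mul_lt_mul_of_pos_right hD hwpos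
  have h5 := mul_le_mul_of_nonneg_left h1 (show (0 : ℝ) ≤ k - 1 + ε by linarith)
  have h6 := mul_le_mul_of_nonneg_left h3.le (show (0 : ℝ) ≤ n * (k - 1) by positivity)
  nlinarith

end Supersaturation

/-! ### Counting small families and comparing asymptotics. -/

section Counting

open Finset

/-- Weight each `S` by `n ^ (T - #S) ≥ 1` and sum over all `S` by the binomial theorem. -/
theorem card_filter_card_le_le {α : Type*} [Fintype α] [DecidableEq α] (T : ℕ) {n : ℕ}
    (hn : 0 < n) :
    ((univ.filter fun S : Finset α => #S ≤ T).card : ℝ) ≤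
      (n : ℝ) ^ T * Real.exp ((Fintype.card α : ℝ) / n) := by
  have hn' : (1 : ℝ) ≤ n := by exact_mod_cast hn
  have h1 : ((univ.filter fun S : Finset α => #S ≤ T).card : ℝ) ≤
      ∑ S : Finset α, (n : ℝ) ^ T * (1 / n : ℝ) ^ #S := by
    rw [card_eq_sum_ones, Nat.cast_sum]
    refine (sum_le_sum fun S hS => ?_).trans
      (sum_le_sum_of_subset_of_nonneg (filter_subset _ _) fun S _ _ => by positivity)
    have hST : #S ≤ T := (mem_filter.1 hS).2
    rw [one_div, inv_pow, Nat.cast_one, ← div_eq_mul_inv, one_le_div (by positivity)]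
    exact pow_le_pow_right₀ hn' hST
  refine h1.trans ?_
  rw [← mul_sum]
  refine mul_le_mul_of_nonneg_left ?_ (by positivity)
  have h2 := Finset.sum_pow_mul_eq_add_pow (1 / n : ℝ) 1 (univ : Finset α)
  simp only [one_pow, mul_one, powerset_univ] at h2
  rw [h2, Finset.card_univ]
  calc ((1 / n : ℝ) + 1) ^ Fintype.card α ≤ Real.exp (1 / n) ^ Fintype.card α :=
        pow_le_pow_left₀ (by positivity) (Real.add_one_le_exp _) _
    _ = Real.exp ((Fintype.card α : ℝ) / n) := by
        rw [← Real.exp_nat_mul]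
        congr 1
        ring

/-- The variance of the binomial distribution, read from Bernstein polynomials at `1 / 2`. -/
theorem sum_sq_two_mul_card_sub (n : ℕ) :
    ∑ A : Finset (Fin n), (2 * (#A : ℝ) - (n : ℝ)) ^ 2 = (n : ℝ) * (2 : ℝ) ^ n := by
  have h := congrArg (Polynomial.eval (1 / 2 : ℝ)) (bernsteinPolynomial.variance ℝ n)
  simp only [Polynomial.eval_finsetSum, bernsteinPolynomial, Polynomial.eval_mul,
    Polynomial.eval_pow, Polynomial.eval_sub, Polynomial.eval_natCast,
    Polynomial.eval_X, Polynomial.eval_one, nsmul_eq_mul] at h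
  have h2 : ∑ A : Finset (Fin n), (2 * (#A : ℝ) - n) ^ 2 =
      ∑ m ∈ range (n + 1), n.choose m • (2 * (m : ℝ) - n) ^ 2 := by
    have := sum_powerset_apply_card (fun m : ℕ => (2 * (m : ℝ) - n) ^ 2)
      (x := (univ : Finset (Fin n)))
    simpa using this
  have h3 : ∑ m ∈ range (n + 1), n.choose m • (2 * (m : ℝ) - n) ^ 2 =
      4 * 2 ^ n * ∑ m ∈ range (n + 1), ((n : ℝ) * (1 / 2) - m) ^ 2 *
        (n.choose m * (1 / 2) ^ m * (1 - 1 / 2) ^ (n - m)) := by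
    rw [mul_sum]
    refine sum_congr rfl fun m hm => ?_
    have hm' : m ≤ n := by
      have := mem_range.1 hm
      omega
    have h4 : (1 / 2 : ℝ) ^ m * (1 - 1 / 2) ^ (n - m) * 2 ^ n = 1 := by
      rw [show (1 - 1 / 2 : ℝ) = 1 / 2 by norm_num, ← pow_add, Nat.add_sub_cancel' hm',
        ← mul_pow]
      norm_num
    rw [nsmul_eq_mul]
    linear_combination -(n.choose m : ℝ) * (2 * (m : ℝ) - n) ^ 2 * h4
  rw [h2, h3, h]
  ring

/-- Chebyshev's inequality: such sets have `|2 * #A - n| > n / 2`. -/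
theorem card_filter_not_middle_le (n : ℕ) (hn : 0 < n) :
    ((univ.filter fun A : Finset (Fin n) => ¬ (n ≤ 4 * #A ∧ 4 * #A ≤ 3 * n)).card : ℝ) ≤
      4 * (2 ^ n / n) := by
  have hn' : (0 : ℝ) < n := by exact_mod_cast hn
  have h1 : ((univ.filter fun A : Finset (Fin n) => ¬ (n ≤ 4 * #A ∧ 4 * #A ≤ 3 * n)).card : ℝ) *
      ((n : ℝ) ^ 2 / 4) ≤ (n : ℝ) * (2 : ℝ) ^ n := by
    rw [← sum_sq_two_mul_card_sub n, ← nsmul_eq_mul, ← sum_const]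
    refine (sum_le_sum fun A hA => ?_).trans
      (sum_le_sum_of_subset_of_nonneg (filter_subset _ _) fun A _ _ => sq_nonneg _)
    have h2 := (mem_filter.1 hA).2
    rcases lt_or_ge (4 * #A) n with h | h
    · have h : (4 * (#A : ℝ)) < n := by exact_mod_cast h
      nlinarith
    · have h : 3 * n < 4 * #A := by
        by_contra h'
        exact h2 ⟨h, by omega⟩
      have h : 3 * (n : ℝ) < 4 * (#A : ℝ) := by exact_mod_cast h
      nlinarith
  rw [← mul_div_assoc, le_div_iff₀ hn']
  refine le_of_mul_le_mul_right ?_ hn'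
  nlinarith

theorem sixteen_pow_le_centralBinom_sq (m : ℕ) (hm : 1 ≤ m) :
    16 ^ m ≤ m.centralBinom ^ 2 * (4 * m) := by
  induction m, hm using Nat.le_induction with
  | base => simp [Nat.centralBinom]
  | succ m hm ih =>
    have h := Nat.succ_mul_centralBinom_succ m
    have h0 : 0 < m + 1 := m.succ_pos
    refine Nat.le_of_mul_le_mul_left ?_ h0
    calc (m + 1) * 16 ^ (m + 1) = 16 * (m + 1) * 16 ^ m := by ring
      _ ≤ 16 * (m + 1) * (m.centralBinom ^ 2 * (4 * m)) := Nat.mul_le_mul_left _ ih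
      _ = 4 * (2 ^ 2 * (4 * m * (m + 1)) * m.centralBinom ^ 2) := by ring
      _ ≤ 4 * (2 ^ 2 * (2 * m + 1) ^ 2 * m.centralBinom ^ 2) := by
          gcongr
          nlinarith
      _ = 4 * (2 * (2 * m + 1) * m.centralBinom) ^ 2 := by ring
      _ = 4 * ((m + 1) * (m + 1).centralBinom) ^ 2 := by rw [h]
      _ = _ := by ring

theorem four_pow_le_choose_middle_sq (n : ℕ) :
    4 ^ n ≤ n.choose (n / 2) ^ 2 * (2 * n + 2) := by
  rcases Nat.even_or_odd' n with ⟨m, rfl | rfl⟩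
  · rcases Nat.eq_zero_or_pos m with rfl | hm
    · simp
    · have h := sixteen_pow_le_centralBinom_sq m hm
      rw [Nat.mul_div_cancel_left m two_pos, ← Nat.centralBinom_eq_two_mul_choose, pow_mul]
      refine (le_of_eq (by norm_num)).trans (h.trans (Nat.mul_le_mul_left _ (by omega)))
  · have h := sixteen_pow_le_centralBinom_sq (m + 1) (by omega)
    have hc : (m + 1).centralBinom = 2 * (2 * m + 1).choose m := by
      rw [Nat.centralBinom_eq_two_mul_choose, show 2 * (m + 1) = 2 * m + 1 + 1 by ring,
        Nat.choose_succ_succ, Nat.choose_symm_half]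
      ring
    rw [show (2 * m + 1) / 2 = m by omega]
    rw [hc] at h
    refine Nat.le_of_mul_le_mul_left ?_ (show 0 < 4 by norm_num)
    calc 4 * 4 ^ (2 * m + 1) = 16 ^ (m + 1) := by
          rw [show (16 : ℕ) = 4 ^ 2 by norm_num, ← pow_mul]
          ring
      _ ≤ _ := h
      _ = _ := by ring

/-- Uses `2 ^ n ≤ √(2n + 2) * n.choose (n / 2)` and, eventually, `log n ^ 4 ≤ n` and `log (log n) ≥
1`. -/
theorem two_pow_div_mul_log_isBigO :
    (fun n : ℕ => (2 : ℝ) ^ n / n * Real.log n) =O[atTop] (fun n : ℕ =>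
      Real.log (Real.log (n : ℝ)) / Real.log (n : ℝ) * (n.choose (n / 2) : ℝ)) := by
  have hcast : Tendsto (fun n : ℕ => (n : ℝ)) atTop atTop := tendsto_natCast_atTop_atTop
  have hlog : Tendsto (fun n : ℕ => Real.log (n : ℝ)) atTop atTop :=
    Real.tendsto_log_atTop.comp hcast
  have hloglog : Tendsto (fun n : ℕ => Real.log (Real.log (n : ℝ))) atTop atTop :=
    Real.tendsto_log_atTop.comp hlog
  have h4 : ∀ᶠ n : ℕ in atTop, ‖Real.log (n : ℝ) ^ 4‖ ≤ 1 * ‖(n : ℝ)‖ :=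
    hcast.eventually ((Real.isLittleO_pow_log_id_atTop (n := 4)).bound one_pos)
  refine IsBigO.of_bound 2 ?_
  filter_upwards [h4, hlog.eventually_ge_atTop 1, hloglog.eventually_ge_atTop 1,
    eventually_ge_atTop 1] with n h4 h1 h2 hn
  have hn' : (1 : ℝ) ≤ n := by exact_mod_cast hn
  set l := Real.log (n : ℝ) with hl
  set N : ℝ := (n.choose (n / 2) : ℝ) with hN
  have hN0 : 0 ≤ N := by positivity
  have hl0 : 0 < l := by linarith
  rw [one_mul, Real.norm_of_nonneg (by positivity), Real.norm_of_nonneg (by positivity)] at h4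
  rw [Real.norm_of_nonneg (by positivity), Real.norm_of_nonneg (by positivity)]
  have hsq : ((2 : ℝ) ^ n) ^ 2 ≤ N ^ 2 * (2 * n + 2) := by
    have := four_pow_le_choose_middle_sq n
    rw [← pow_mul, mul_comm n 2, pow_mul]
    rw [show ((2 : ℝ) ^ 2) = 4 by norm_num, hN]
    exact_mod_cast this
  have key : (2 : ℝ) ^ n * l ^ 2 ≤ 2 * N * n := by
    refine le_of_sq_le_sq ?_ (by positivity)
    calc ((2 : ℝ) ^ n * l ^ 2) ^ 2 = ((2 : ℝ) ^ n) ^ 2 * l ^ 4 := by ring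
      _ ≤ (N ^ 2 * (2 * n + 2)) * n := mul_le_mul hsq h4 (by positivity) (by positivity)
      _ ≤ (N ^ 2 * (4 * n)) * n := by
          gcongr
          linarith
      _ = _ := by ring
  calc (2 : ℝ) ^ n / n * l ≤ 2 * (1 / l * N) := by
        rw [div_mul_eq_mul_div, div_le_iff₀ (by linarith),
          show 2 * (1 / l * N) * (n : ℝ) = (2 * N * n) / l by ring, le_div_iff₀ hl0]
        linarith
    _ ≤ 2 * (Real.log l / l * N) := by
        gcongr

end Counting

/-! ### Construction and number of the containers. -/

section Main

open Finset

theorem PosetContains.of_forall_covBy {P α : Type*} [PartialOrder P] [Finite P]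
    {F : Finset (Finset α)} (f : P → Finset α) (hinj : Function.Injective f) (hF : ∀ v, f v ∈ F)
    (hf : ∀ a b, a ⋖ b → f a ⊆ f b) : PosetContains F P := by
  classical
  have := Fintype.ofFinite P
  let := Fintype.toLocallyFiniteOrder (α := P)
  refine ⟨⟨fun v => ⟨f v, hF v⟩, ?_⟩, fun v w h => hinj (congrArg Subtype.val h)⟩
  rw [monotone_iff_forall_covBy]
  exact fun a b h => hf a b h

open Classical in
theorem exists_containers {P : Type*} [PartialOrder P] [Fintype P] {k : ℕ}
    (hTree : IsTreePoset P) (hGraded : IsGradedPoset P) (hHeight : HasPosetHeight P k)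
    {ε : ℝ} (hε : 0 < ε) {n D : ℕ} (hD1 : 1 ≤ D)
    (hD : 4 * D * (Fintype.card P : ℝ) ^ 2 * (k - 1 + ε) < ε * n) :
    ∃ Ψ : {F : SetSystem n // PosetFree F P} → SetSystem n × SetSystem n,
      (∀ F, (Ψ F).1 ⊆ F.1 ∧ F.1 ⊆ (Ψ F).1 ∪ (Ψ F).2) ∧
      (∀ F, (#(Ψ F).2 : ℝ) ≤ ((k : ℝ) - 1 + ε) * (n.choose (n / 2) : ℝ)) ∧
      #(univ.image Ψ) ≤ #(univ.filter fun S : SetSystem n => #S ≤ 2 ^ n / D) ^ Fintype.card P *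
        (#(univ.filter fun S : SetSystem n =>
            #S ≤ Fintype.card P * (2 ^ n / D * Fintype.card P)) *
          2 ^ #(univ.filter fun A : Finset (Fin n) => ¬ (n ≤ 4 * #A ∧ 4 * #A ≤ 3 * n))) := by
  obtain ⟨T, hadj, hchild⟩ := SimpleGraph.IsTree.exists_treeRooting hTree
  obtain ⟨ρ, hρ, hcov⟩ := hGraded.exists_rank hHeight
  -- The value at the root is `false`, which is harmless: the root has no parent.
  let up : P → Bool := fun x => decide (∃ y, T.child x y ∧ y ⋖ x)
  have hup_true : ∀ x y, T.child x y → up x = true → y ⋖ x := by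
    intro x y hxy hu
    obtain ⟨z, hz, hzx⟩ := of_decide_eq_true hu
    rwa [T.parent_unique hxy hz]
  have hup_false : ∀ x y, T.child x y → up x = false → x ⋖ y := by
    intro x y hxy hu
    have h1 := of_decide_eq_false hu
    rcases (hadj x y hxy : x ⋖ y ∨ y ⋖ x) with h | h
    · exact h
    · exact absurd ⟨y, hxy, h⟩ h1
  have hup : ∀ x y, T.child x y → if up x then ρ x = ρ y + 1 else ρ y = ρ x + 1 := by
    intro x y hxy
    cases hu : up x
    · simpa using hcov _ _ (hup_false x y hxy hu)
    · simpa using hcov _ _ (hup_true x y hxy hu)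
  let N : P → Finset (Fin n) → SetSystem n := fun x => dirNbr (up x)
  let M : SetSystem n := univ.filter fun A => n ≤ 4 * #A ∧ 4 * #A ≤ 3 * n
  choose g S hsys hprop using fun F : {F : SetSystem n // PosetFree F P} =>
    exists_containerSystem T N M F.1 D (Fintype.card P) hD1
  let R : {F : SetSystem n // PosetFree F P} → P → SetSystem n := fun F v =>
    (S F v).biUnion (N v)
  let G : {F : SetSystem n // PosetFree F P} → SetSystem n := fun F =>
    M \ ((univ.biUnion fun v => g F v ∩ R F v) ∪ g F T.root)
  have hroot : ∀ F, Disjoint F.1 (g F T.root) := by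
    intro F
    rw [disjoint_left]
    intro A hA hAg
    obtain ⟨f, hinj, hfF, hf⟩ := T.exists_embedding N F.1 (g F) (by
      intro x y hxy A hA hAg
      have h1 := (hprop F x).2.2.2 A hA (((hsys F y A).1 hAg).2 x hxy)
      exact h1.trans (card_le_card
        (inter_subset_inter_right (inter_subset_inter_right sdiff_subset)))) ⟨A, hA, hAg⟩
    refine F.2 (PosetContains.of_forall_covBy f hinj hfF fun a b hab => ?_)
    rcases hchild a b (Or.inl hab) with h | h
    · have h1 := hf a b h
      cases hu : up a
      · simp only [N, dirNbr, hu, mem_filter, mem_univ, true_and] at h1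
        exact h1.1
      · exact absurd (hup_true a b h hu).lt hab.lt.not_gt
    · have h1 := hf b a h
      cases hu : up b
      · exact absurd (hup_false b a h hu).lt hab.lt.not_gt
      · simp only [N, dirNbr, hu, mem_filter, mem_univ, true_and] at h1
        exact h1.1
  have hScard : ∀ F v, #(S F v) ≤ 2 ^ n / D := by
    intro F v
    rw [Nat.le_div_iff_mul_le hD1]
    refine (hprop F v).2.1.trans ((card_le_univ _).trans (le_of_eq ?_))
    simp
  have hHM : ∀ F, #((F.1 \ G F) ∩ M) ≤ Fintype.card P * (2 ^ n / D * Fintype.card P) := by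
    intro F
    have h1 : (F.1 \ G F) ∩ M ⊆ univ.biUnion fun v => g F v ∩ R F v ∩ F.1 := by
      intro A hA
      simp only [G, mem_inter, Finset.mem_sdiff, mem_union, not_and, not_not] at hA
      obtain ⟨⟨hAF, hAG⟩, hAM⟩ := hA
      rcases hAG hAM with h | h
      · obtain ⟨v, -, hv⟩ := mem_biUnion.1 h
        exact mem_biUnion.2 ⟨v, mem_univ v, mem_inter.2 ⟨hv, hAF⟩⟩
      · exact absurd h (disjoint_left.1 (hroot F) hAF)
    refine (card_le_card h1).trans (card_biUnion_le.trans ?_)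
    rw [← Finset.card_univ, ← smul_eq_mul, ← sum_const]
    refine sum_le_sum fun v _ => (hprop F v).2.2.1.trans ?_
    exact Nat.mul_le_mul_right _ (hScard F v)
  -- The pair is a function of this code: the fingerprints give `G F`, and the other entries give
  -- `F.1 \ G F`.
  let code : {F : SetSystem n // PosetFree F P} → (P → SetSystem n) × SetSystem n × SetSystem n :=
    fun F => (S F, (F.1 \ G F) ∩ M, (F.1 \ G F) \ M)
  let Ψ : {F : SetSystem n // PosetFree F P} → SetSystem n × SetSystem n :=
    fun F => (F.1 \ G F, G F)
  refine ⟨Ψ, fun F => ⟨sdiff_subset, fun A hA => ?_⟩, fun F => ?_, ?_⟩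
  · by_cases h : A ∈ G F
    · exact mem_union_right _ h
    · exact mem_union_left _ (mem_sdiff.2 ⟨hA, h⟩)
  · refine card_le_of_disjoint_root T up ρ hρ hup hε hD (G F) ?_ (fun v => g F v \ R F v) ?_ ?_
    · intro A hA
      have hAM : A ∈ M := (mem_sdiff.1 hA).1
      simpa [M] using hAM
    · intro A hA v
      simp only [G, Finset.mem_sdiff, mem_union, mem_biUnion, mem_univ, true_and, not_or,
        not_exists, mem_inter, not_and] at hA
      obtain ⟨hAM, hAR, -⟩ := hA
      by_cases hv : A ∈ g F v
      · exact Or.inl (mem_sdiff.2 ⟨hv, hAR v hv⟩)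
      · right
        by_contra! hcon
        exact hv ((hsys F v A).2 ⟨hAM, hcon⟩)
    · rw [disjoint_left]
      intro A hA hA'
      simp only [G, Finset.mem_sdiff, mem_union, not_or] at hA
      exact hA.2.2 (mem_sdiff.1 hA').1
  · have hfac : Function.FactorsThrough Ψ code := by
      intro F F' h
      simp only [code, Prod.mk.injEq] at h
      obtain ⟨hS, h1, h2⟩ := h
      have hg : g F = g F' := (hsys F).unique (hS ▸ hsys F')
      have hG : G F = G F' := by
        simp only [G, R, hg, hS]
      have hH : F.1 \ G F = F'.1 \ G F' := by
        rw [← sdiff_union_inter (F.1 \ G F) M, ← sdiff_union_inter (F'.1 \ G F') M, h1, h2]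
      simp only [Ψ, hG, Prod.mk.injEq, and_true]
      rw [← hG, hH, hG]
    let K : Finset ((P → SetSystem n) × SetSystem n × SetSystem n) :=
      Fintype.piFinset (fun _ : P => univ.filter fun S : SetSystem n => #S ≤ 2 ^ n / D) ×ˢ
        (univ.filter fun S : SetSystem n =>
            #S ≤ Fintype.card P * (2 ^ n / D * Fintype.card P)) ×ˢ
          (univ.filter fun A : Finset (Fin n) => ¬ (n ≤ 4 * #A ∧ 4 * #A ≤ 3 * n)).powerset
    have hK : univ.image code ⊆ K := by
      intro c hc
      obtain ⟨F, -, rfl⟩ := mem_image.1 hc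
      simp only [K, code, mem_product, Fintype.mem_piFinset, mem_filter, mem_univ, true_and,
        mem_powerset]
      refine ⟨hScard F, hHM F, fun A hA => ?_⟩
      have := (mem_sdiff.1 hA).2
      simpa [M] using this
    have hKcard : #K = #(univ.filter fun S : SetSystem n => #S ≤ 2 ^ n / D) ^ Fintype.card P *
        (#(univ.filter fun S : SetSystem n =>
            #S ≤ Fintype.card P * (2 ^ n / D * Fintype.card P)) *
          2 ^ #(univ.filter fun A : Finset (Fin n) => ¬ (n ≤ 4 * #A ∧ 4 * #A ≤ 3 * n))) := by
      rw [card_product, card_product, card_powerset, Fintype.card_piFinset, prod_const,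
        Finset.card_univ]
    rw [← hKcard]
    have himg : univ.image Ψ =
        (univ.image code).image (Function.extend code Ψ fun _ => (∅, ∅)) := by
      rw [image_image]
      exact image_congr fun F _ => (hfac.extend_apply _ F).symm
    rw [himg]
    exact card_image_le.trans (card_le_card hK)

/-- An upper bound for the logarithm of the number of containers. -/
theorem log_le_of_le_count {m n D c : ℕ} (hn : 3 ≤ n) (hm : 1 ≤ m) {d : ℝ} (hd : 0 < d)
    (hdD : d * n ≤ D) (hc : 0 < c) (a b o : ℕ)
    (ha : (a : ℝ) ≤ (n : ℝ) ^ (2 ^ n / D) * Real.exp (2 ^ n / n))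
    (hb : (b : ℝ) ≤ (n : ℝ) ^ (m * (2 ^ n / D * m)) * Real.exp (2 ^ n / n))
    (ho : (o : ℝ) ≤ 4 * (2 ^ n / n)) (hcab : c ≤ a ^ m * (b * 2 ^ o)) :
    Real.log c ≤ ((m + m * m) / d + m + 5) * ((2 : ℝ) ^ n / n * Real.log n) := by
  have hn' : (3 : ℝ) ≤ n := by exact_mod_cast hn
  have hn0 : (0 : ℝ) < n := by linarith
  have hl1 : 1 ≤ Real.log n := by
    rw [Real.le_log_iff_exp_le hn0]
    exact (Real.exp_one_lt_three.le).trans hn'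
  have hab : a ≠ 0 ∧ b ≠ 0 := by
    constructor
    · rintro rfl
      rw [zero_pow (by omega), zero_mul] at hcab
      omega
    · rintro rfl
      simp at hcab
      omega
  have ha0 : (0 : ℝ) < a := by exact_mod_cast Nat.pos_of_ne_zero hab.1
  have hb0 : (0 : ℝ) < b := by exact_mod_cast Nat.pos_of_ne_zero hab.2
  set V : ℝ := (2 : ℝ) ^ n / n with hV
  have hV0 : 0 ≤ V := by positivity
  have hT : (((2 ^ n / D : ℕ)) : ℝ) ≤ V / d := by
    have hD0 : (0 : ℝ) < D := lt_of_lt_of_le (by positivity) hdD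
    refine Nat.cast_div_le.trans ?_
    push_cast
    rw [hV, div_div, mul_comm (n : ℝ) d]
    exact div_le_div_of_nonneg_left (by positivity) (by positivity) hdD
  set t : ℝ := ((2 ^ n / D : ℕ) : ℝ) with ht
  have hla : Real.log a ≤ t * Real.log n + V := by
    have := Real.log_le_log ha0 ha
    rwa [Real.log_mul (by positivity) (by positivity), Real.log_exp, Real.log_pow] at this
  have hlb : Real.log b ≤ m * (t * m) * Real.log n + V := by
    have := Real.log_le_log hb0 hb
    rw [Real.log_mul (by positivity) (by positivity), Real.log_exp, Real.log_pow] at this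
    push_cast at this
    simpa [ht] using this
  have hlc : Real.log c ≤ m * Real.log a + (Real.log b + o * Real.log 2) := by
    have h1 : (c : ℝ) ≤ (a : ℝ) ^ m * ((b : ℝ) * 2 ^ o) := by exact_mod_cast hcab
    have := Real.log_le_log (by exact_mod_cast hc) h1
    rwa [Real.log_mul (by positivity) (by positivity), Real.log_mul (by positivity) (by positivity),
      Real.log_pow, Real.log_pow] at this
  have hlog2 : Real.log 2 ≤ 1 := by
    have := Real.log_two_lt_d9
    linarith
  have hm0 : (0 : ℝ) ≤ m := by positivity
  have h1 : (o : ℝ) * Real.log 2 ≤ 4 * V :=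
    (mul_le_of_le_one_right (by positivity) hlog2).trans ho
  have h2 : V ≤ V * Real.log n := le_mul_of_one_le_right hV0 hl1
  have h3 : t * Real.log n ≤ V / d * Real.log n := mul_le_mul_of_nonneg_right hT (by linarith)
  calc Real.log c ≤ m * Real.log a + (Real.log b + o * Real.log 2) := hlc
    _ ≤ m * (t * Real.log n + V) + ((m * (t * m) * Real.log n + V) + 4 * V) := by
        gcongr
    _ = (m + m * m) * (t * Real.log n) + (m + 5) * V := by ring
    _ ≤ (m + m * m) * (V / d * Real.log n) + (m + 5) * (V * Real.log n) := by
        gcongr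
    _ = _ := by
        field_simp
        ring

end Main

/-! ### Choice of parameters and conclusion. -/

theorem mainTheorem3 (P : Type*) [PartialOrder P] [Finite P] (k : ℕ)
    (hTree : IsTreePoset P) (hGraded : IsGradedPoset P) (hHeight : HasPosetHeight P k)
    (ε : ℝ) (hε : 0 < ε) :
    ∃ (C : (n : ℕ) → Finset (SetSystem n × SetSystem n))
      (Ψ : (n : ℕ) → {F : SetSystem n // PosetFree F P} → SetSystem n × SetSystem n)
      (g : ℕ → ℝ),
      (∀ n F, Ψ n F ∈ C n) ∧
      (∀ n F, (Ψ n F).1 ⊆ F.1 ∧ F.1 ⊆ (Ψ n F).1 ∪ (Ψ n F).2) ∧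
      (∀ n, ∀ p ∈ C n, (p.2.card : ℝ) ≤ ((k : ℝ) - 1 + ε) * (n.choose (n / 2) : ℝ)) ∧
      (∀ n, ((C n).card : ℝ) = (2 : ℝ) ^ (g n)) ∧
      g =O[atTop] (fun n : ℕ =>
        Real.log (Real.log (n : ℝ)) / Real.log (n : ℝ) * (n.choose (n / 2) : ℝ)) := by
  classical
  have := Fintype.ofFinite P
  have hne : Nonempty P := hTree.connected.nonempty
  set m := Fintype.card P with hm
  have hm1 : 1 ≤ m := Fintype.card_pos
  have hm0 : (0 : ℝ) < m := by exact_mod_cast hm1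
  have hk : (0 : ℝ) ≤ (k : ℝ) - 1 := by
    obtain ⟨ρ, hρ, -⟩ := hGraded.exists_rank hHeight
    obtain ⟨v⟩ := hne
    have h1 : 1 ≤ k := by
      have := hρ v
      omega
    have : (1 : ℝ) ≤ k := by exact_mod_cast h1
    linarith
  have hkε : (0 : ℝ) < (k : ℝ) - 1 + ε := by linarith
  -- `D` will be `⌈d * n⌉₊ ≤ 2 * d * n` once `d * n ≥ 1`, which turns the factor 4 into 8.
  obtain ⟨d, hd0, hd⟩ : ∃ d : ℝ, 0 < d ∧ 8 * d * (m : ℝ) ^ 2 * (k - 1 + ε) < ε := by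
    refine ⟨ε / (16 * (m : ℝ) ^ 2 * (k - 1 + ε)), by positivity, ?_⟩
    have : 8 * (ε / (16 * (m : ℝ) ^ 2 * (k - 1 + ε))) * (m : ℝ) ^ 2 * (k - 1 + ε) = ε / 2 := by
      field_simp
      norm_num
    linarith
  have hfree : ∀ n, PosetFree (∅ : SetSystem n) P := by
    rintro n ⟨f, -⟩
    obtain ⟨v⟩ := hne
    exact absurd (f v).2 (Finset.notMem_empty _)
  have hΨ : ∀ n : ℕ, ∃ Ψ : {F : SetSystem n // PosetFree F P} → SetSystem n × SetSystem n,
      (∀ F, (Ψ F).1 ⊆ F.1 ∧ F.1 ⊆ (Ψ F).1 ∪ (Ψ F).2) ∧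
      (∀ F, ((Ψ F).2.card : ℝ) ≤ ((k : ℝ) - 1 + ε) * (n.choose (n / 2) : ℝ)) ∧
      (3 ≤ n → 1 / d ≤ n → Real.log (Finset.univ.image Ψ).card ≤
        ((m + m * m) / d + m + 5) * ((2 : ℝ) ^ n / n * Real.log n)) := by
    intro n
    by_cases hn : 3 ≤ n ∧ 1 / d ≤ n
    · obtain ⟨hn3, hnd⟩ := hn
      have hnd' : 1 ≤ d * n := by
        rw [div_le_iff₀ hd0] at hnd
        linarith
      have hn0 : (0 : ℝ) < n := by
        have : 0 < n := by omega
        exact_mod_cast this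
      have hDle : d * n ≤ ⌈d * n⌉₊ := Nat.le_ceil _
      have hDlt : (⌈d * n⌉₊ : ℝ) < d * n + 1 := Nat.ceil_lt_add_one (by positivity)
      have hD1 : 1 ≤ ⌈d * n⌉₊ := Nat.one_le_ceil_iff.2 (by positivity)
      have hD : 4 * (⌈d * n⌉₊ : ℝ) * (m : ℝ) ^ 2 * (k - 1 + ε) < ε * n := by
        calc 4 * (⌈d * n⌉₊ : ℝ) * (m : ℝ) ^ 2 * (k - 1 + ε)
            ≤ 4 * (2 * (d * n)) * (m : ℝ) ^ 2 * (k - 1 + ε) := by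
              gcongr
              linarith
          _ = 8 * d * (m : ℝ) ^ 2 * (k - 1 + ε) * n := by ring
          _ < ε * n := mul_lt_mul_of_pos_right hd hn0
      obtain ⟨Ψ, h1, h2, h3⟩ := exists_containers hTree hGraded hHeight hε hD1 hD
      refine ⟨Ψ, h1, h2, fun _ _ => ?_⟩
      have hcpos : 0 < (Finset.univ.image Ψ).card :=
        Finset.card_pos.2 ⟨_, Finset.mem_image_of_mem Ψ (Finset.mem_univ ⟨∅, hfree n⟩)⟩
      have hcard : ∀ T, (((Finset.univ.filter fun S : SetSystem n => S.card ≤ T).card : ℕ) : ℝ) ≤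
          (n : ℝ) ^ T * Real.exp (2 ^ n / n) := by
        intro T
        have := card_filter_card_le_le (α := Finset (Fin n)) T (show 0 < n by omega)
        simpa using this
      refine log_le_of_le_count hn3 hm1 hd0 hDle hcpos _ _ _ (hcard _) (hcard _)
        (card_filter_not_middle_le n (by omega)) ?_
      convert h3
    -- For the finitely many small `n` the trivial pair suffices, since the count matters only
    -- asymptotically.
    · refine ⟨fun F => (F.1, ∅), fun F => ⟨subset_rfl, Finset.subset_union_left⟩, fun F => ?_,
        fun h1 h2 => absurd ⟨h1, h2⟩ hn⟩
      simp only [Finset.card_empty, Nat.cast_zero]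
      positivity
  choose Ψ h1 h2 h3 using hΨ
  have hpos : ∀ n, 0 < (Finset.univ.image (Ψ n)).card := by
    intro n
    exact Finset.card_pos.2 ⟨_, Finset.mem_image_of_mem (Ψ n) (Finset.mem_univ ⟨∅, hfree n⟩)⟩
  refine ⟨fun n => Finset.univ.image (Ψ n), Ψ, fun n => Real.logb 2 (Finset.univ.image (Ψ n)).card,
    fun n F => Finset.mem_image_of_mem _ (Finset.mem_univ F), h1, ?_, ?_, ?_⟩
  · intro n p hp
    obtain ⟨F, -, rfl⟩ := Finset.mem_image.1 hp
    exact h2 n F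
  · intro n
    exact (Real.rpow_logb two_pos (by norm_num) (by exact_mod_cast hpos n)).symm
  · refine IsBigO.trans ?_ two_pow_div_mul_log_isBigO
    refine IsBigO.of_bound (((m + m * m) / d + m + 5) / Real.log 2) ?_
    filter_upwards [eventually_ge_atTop 3,
      tendsto_natCast_atTop_atTop.eventually_ge_atTop (1 / d)] with n hn hnd
    have hlog2 : 0 < Real.log 2 := Real.log_pos one_lt_two
    have hc1 : (1 : ℝ) ≤ (Finset.univ.image (Ψ n)).card := by exact_mod_cast hpos n
    have hln : 0 ≤ Real.log n := Real.log_natCast_nonneg n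
    rw [Real.norm_of_nonneg (Real.logb_nonneg one_lt_two hc1), Real.norm_of_nonneg (by positivity),
      Real.logb, div_mul_eq_mul_div]
    exact div_le_div_of_nonneg_right (h3 n hn hnd) hlog2.le
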